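/- **Theorem (Density of symmetric QSP for absolutely summable functions).** Let $X=[-1,1]$, $\xi>0$, $\delta>0$, $C\in\mathbb R$. Let $F(X,\xi)\subset C(X,\mathbb R)$ be the set of functions $f$ with $|f|\le 1$, of definite parity ($f(-x)=f(x)$ for all $x$, or $f(-x)=-f(x)$ for all $x$), and differentiable on $X$ with $|f'|\le \xi$. Let $G(X)$ be the closure, in the supremum norm, of the set of all $g\in F(X,\xi)$ with $|g(x)|\le 1-\delta$ on $X$ and $$g(x)=\sum_{k=0}^\infty c_kT_k(x)\quad (x\in X),\qquad \sum_{k=0}^\infty |c_k|<C,$$ where $T_k$ is the $k$-th Chebyshev polynomial of the first kind. For $\Phi=(\phi_0,\dots,\phi_n)\in\mathbb R^{n+1}$ put $$U(\Phi,x)=e^{i\phi_0\sigma_z}\prod_{j=1}^{n}\left[W(x)\,e^{i\phi_j\sigma_z}\right],\qquad W(x)=e^{i\arccos(x)\sigma_x}=\begin{pmatrix}x&i\sqrt{1-x^2}\\ i\sqrt{1-x^2}&x\end{pmatrix},$$ and $S(\Phi,x)=H\,U(\Phi,x)\,H$ with $H$ the Hadamard gate, i.e. the protocol with the roles of $\sigma_x$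 and $\sigma_z$ exchanged. Write $\Phi^R$ for the reversed list. The *symmetric QSP ansatz* is the set of all functions $x\mapsto S(\Phi,x)$ with $n\ge 0$ and $\Phi=\Phi^R\in\mathbb R^{n+1}$. The *symmetric QSP ansatz with constant-space LCU and trivial-phase QSVT* is the set of all functions obtained as follows from some $n\ge0$, $\Phi=\Phi^R\in\mathbb R^{n+1}$ and odd $a=2m+1$ ($m\ge 0$). With one additional qubit (the first tensor factor) form $$V=(H\otimes I)\big(|0\rangle\langle0|\otimes S(\Phi,x)+|1\rangle\langle1|\otimes S(\Phi^R,x)\big)(H\otimes I)\,(I\otimes(-i\sigma_x)),$$ then $Q=V\,(RV^\dagger RV)^{m}$ with $R=2|00\rangle\langle00|-I$ (an alternating product with $a$ factors $V,V^\dagger$), and take the $2\times 2$ block of $Q\,(I\otimes i\sigma_x)$ in which the additional qubit starts and ends in $|0\rangle$. Let $\Pi(M)=\operatorname{Im}\langle 0|M|1\rangle$ be the imaginary part of the top-right entry. Call a set $A$ of matrix-valued functions on $X$ *$\Pi$-dense* in a class of functions if for every $\varepsilon>0$ and every $f$ in the class there is $M\in A$ with $|\Pi(M(x))-f(x)|<\varepsilon$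 for all $x\in X$. Then $G(X)$ is compact, $G(X)\subsetneq \overline{F(X,\xi)}\subsetneq C(X,\mathbb R)$ (closure in the supremum norm), and both the symmetric QSP ansatz and the symmetric QSP ansatz with constant-space LCU and trivial-phase QSVT are $\Pi$-dense in $G(X)$. -/

import Mathlib

open scoped Matrix Kronecker

noncomputable section

namespace QSP

/-- The signal domain `X = [-1, 1]`. -/
abbrev X : Type := Set.Icc (-1 : ℝ) 1

/-! ### Function classes -/

/-- A function on `[-1, 1]` as a function on `ℝ` (constant continuation outside the interval);
only its values on `[-1, 1]` are ever used. -/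
def ext (f : C(X, ℝ)) : ℝ → ℝ := Set.IccExtend (by norm_num : (-1 : ℝ) ≤ 1) f

/-- The common QSP function space `F(X, ξ)`: continuous real functions on `[-1, 1]` that are bounded
by one, have definite parity, and are differentiable on `[-1, 1]` (one-sidedly at the endpoints)
with derivative bounded by `ξ`. -/
def commonSpace (ξ : ℝ) : Set C(X, ℝ) :=
  {f | (∀ x : X, |f x| ≤ 1) ∧
    (∃ k : Fin 2, ∀ x ∈ Set.Icc (-1 : ℝ) 1, ext f (-x) = (-1) ^ (k : ℕ) * ext f x) ∧
    ∀ x ∈ Set.Icc (-1 : ℝ) 1, ∃ d : ℝ, |d| ≤ ξ ∧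
      HasDerivWithinAt (ext f) d (Set.Icc (-1 : ℝ) 1) x}

/-- The functions of the common space `F(X, ξ)` that are bounded by `1 - δ` and have a Chebyshev
expansion `g = ∑ cₖ Tₖ` with `∑ |cₖ| < C`. -/
def summableClass (ξ δ C : ℝ) : Set C(X, ℝ) :=
  {g | g ∈ commonSpace ξ ∧ (∀ x : X, |g x| ≤ 1 - δ) ∧
    ∃ c : ℕ → ℝ, Summable (fun k => |c k|) ∧ ∑' k, |c k| < C ∧
      ∀ x : X, HasSum (fun k : ℕ => c k * (Polynomial.Chebyshev.T ℝ k).eval (x : ℝ)) (g x)}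

/-- `G(X)`: the closure of the class above in the supremum norm. -/
def closedClass (ξ δ C : ℝ) : Set C(X, ℝ) := closure (summableClass ξ δ C)

/-! ### Protocols -/

/-- A single-qubit operator. -/
abbrev Op : Type := Matrix (Fin 2) (Fin 2) ℂ

/-- The signal unitary `W(x) = exp(i arccos(x) σ_x)`. -/
def signal (x : ℝ) : Op :=
  !![(x : ℂ), Complex.I * (Real.sqrt (1 - x ^ 2) : ℂ);
     Complex.I * (Real.sqrt (1 - x ^ 2) : ℂ), (x : ℂ)]

/-- The phase unitary `exp(i φ σ_z)`. -/
def phase (φ : ℝ) : Op :=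
  !![Complex.exp (Complex.I * φ), 0; 0, Complex.exp (-(Complex.I * φ))]

/-- The QSP protocol `U(Φ, x) = e^{iφ₀σ_z} ∏_{j=1}^{n} (W(x) e^{iφⱼσ_z})`, factors in this order. -/
def protocol {n : ℕ} (Φ : Fin (n + 1) → ℝ) (x : ℝ) : Op :=
  phase (Φ 0) * (List.ofFn fun j : Fin n => signal x * phase (Φ j.succ)).prod

/-- The reversed phase list `Φ^R`. -/
def reversal {n : ℕ} (Φ : Fin (n + 1) → ℝ) : Fin (n + 1) → ℝ := fun j => Φ j.rev

/-- Symmetric phases: `Φ^R = Φ`. -/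
def IsSymmetric {n : ℕ} (Φ : Fin (n + 1) → ℝ) : Prop := reversal Φ = Φ

/-- The Hadamard gate. -/
def hadamard : Op := ((Real.sqrt 2 : ℂ)⁻¹) • !![1, 1; 1, -1]

/-- The Pauli gate `σ_x`. -/
def pauliX : Op := !![0, 1; 1, 0]

/-- The protocol `U(Φ, x)` with the roles of `σ_x` and `σ_z` exchanged by Hadamard gates: the signal
becomes `diag(e^{iθ}, e^{-iθ})` with `x = cos θ`, and the phases become `exp(i φ σ_x)`. -/
def hadamardProtocol {n : ℕ} (Φ : Fin (n + 1) → ℝ) (x : ℝ) : Op :=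
  hadamard * protocol Φ x * hadamard

/-- The symmetric QSP ansatz: all protocols with symmetric real phases, of every length. -/
def symmetricAnsatz : Set (X → Op) :=
  {U | ∃ (n : ℕ) (Φ : Fin (n + 1) → ℝ), IsSymmetric Φ ∧ U = fun x : X => hadamardProtocol Φ x}

/-! ### The circuit with one additional qubit

Operators on two qubits are indexed by `Fin 2 × Fin 2`: first the additional qubit, then the
original one. -/

/-- A two-qubit operator. -/
abbrev Op₂ : Type := Matrix (Fin 2 × Fin 2) (Fin 2 × Fin 2) ℂ

/-- The linear combination of unitaries (equal weights, one additional qubit) of the protocol with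
phases `Φ` and the protocol with the reversed phases: the block of the additional qubit in state
`|0⟩` is the mean of the two protocols. -/
def lcu {n : ℕ} (Φ : Fin (n + 1) → ℝ) (x : ℝ) : Op₂ :=
  (hadamard ⊗ₖ (1 : Op)) *
    (!![1, 0; 0, 0] ⊗ₖ hadamardProtocol Φ x + !![0, 0; 0, 1] ⊗ₖ hadamardProtocol (reversal Φ) x) *
    (hadamard ⊗ₖ (1 : Op))

/-- The block encoding whose top-left entry `⟨00|·|00⟩` is the imaginary part of the top-right entry
of the protocol: the fixed gate `-i σ_x` moves `⟨00|lcu|01⟩` there. -/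
def blockEncoding {n : ℕ} (Φ : Fin (n + 1) → ℝ) (x : ℝ) : Op₂ :=
  lcu Φ x * ((1 : Op) ⊗ₖ ((-Complex.I) • pauliX))

/-- The reflection `2|00⟩⟨00| - I` about the state that marks the encoded block. -/
def reflection : Op₂ := 2 • (!![1, 0; 0, 0] ⊗ₖ !![1, 0; 0, 0]) - 1

/-- The QSVT protocol with trivial phases and odd length `2m + 1`: the alternating product
`V R V† R V ⋯ R V† R V` with `2m + 1` factors `V`, `V†`. It acts by the Chebyshev polynomial
`T_{2m+1}` on the block that is encoded in `V`. -/
def trivialQSVT (m : ℕ) (V : Op₂) : Op₂ :=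
  V * (reflection * Vᴴ * reflection * V) ^ m

/-- The block of a two-qubit operator in which the additional qubit starts and ends in `|0⟩`. -/
def zeroBlock (M : Op₂) : Op := fun i j => M (0, i) (0, j)

/-- The composed circuit: symmetric protocol, LCU with one additional qubit, QSVT with trivial
phases, and the fixed gate `i σ_x`, which moves the top-left entry back to the top-right. -/
def composedProtocol {n : ℕ} (Φ : Fin (n + 1) → ℝ) (m : ℕ) (x : ℝ) : Op₂ :=
  trivialQSVT m (blockEncoding Φ x) * ((1 : Op) ⊗ₖ (Complex.I • pauliX))

/-- The ansatz of all composed circuits, read in the block where the additional qubit is `|0⟩`. -/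
def composedAnsatz : Set (X → Op) :=
  {U | ∃ (n : ℕ) (Φ : Fin (n + 1) → ℝ) (m : ℕ), IsSymmetric Φ ∧
    U = fun x : X => zeroBlock (composedProtocol Φ m x)}

/-! ### Density under a projection -/

/-- `Π`: the imaginary part of the top-right matrix element in the computational basis. -/
def imTopRight (U : Op) : ℝ := (U 0 1).im

/-- A set `A` of operator-valued functions on `X` is `P`-dense in a class `S` of functions if every
`f ∈ S` is approximated under `P`, uniformly over `X` and to every precision, by an element
of `A`. -/
def IsDenseUnder (P : Op → ℝ) (A : Set (X → Op)) (S : Set C(X, ℝ)) : Prop :=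
  ∀ ε : ℝ, 0 < ε → ∀ f ∈ S, ∃ U ∈ A, ∀ x : X, |P (U x) - f x| < ε

end QSP

end

/-! Write x = cos θ. Symmetric phases produce exactly matrices `symMatrix f G` with f real; in the
frame rotated by Hadamard gates, `imTopRight` reads off f. So density reduces to realizing enough
functions f. Let f be a polynomial of definite parity in x with |f| < 1 on [-1, 1]. Then 1 - f² is a
polynomial in cos² θ, positive on [0, 1], and a Fejér–Riesz factorization writes it as |G|² with G a
trigonometric polynomial with real coefficients and the same degree bound as f
(`exists_isTrigPoly_normSq`). A pair with f² + |G|² = 1 is then peeled symmetrically, two degrees at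
a time, down to a trivial pair (`isSymmetricProtocol_symMatrix_of_isTrigPoly`). Weierstrass
approximation followed by projection to the right parity supplies the polynomials; the margin δ
keeps them strictly below 1. The composed circuit with m = 0 reproduces the symmetric protocol, so
its density follows. Compactness is Arzelà–Ascoli for uniformly bounded ξ-Lipschitz functions; the
constants 1 and 2 witness the strict inclusions. -/

namespace SymmetricQSP

/-! ### Trigonometric polynomials with real coefficients and frequencies of one parity -/

open Polynomial Complex

/-- `h(θ) = ∑ aₖ e^{ikθ}` with real coefficients and `k ∈ {-d, -d + 2, …, d}`. -/
def IsTrigPoly (d : ℕ) (h : ℝ → ℂ) : Prop :=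
  ∃ A : ℝ[X], A.natDegree ≤ d ∧ ∀ θ : ℝ, exp (θ * I) ^ d * h θ = aeval (exp (θ * I) ^ 2) A

theorem IsTrigPoly.mul {d e : ℕ} {h k : ℝ → ℂ} (hh : IsTrigPoly d h) (hk : IsTrigPoly e k) :
    IsTrigPoly (d + e) (fun θ => h θ * k θ) := by
  obtain ⟨A, hA, hA'⟩ := hh
  obtain ⟨B, hB, hB'⟩ := hk
  refine ⟨A * B, natDegree_mul_le_of_le hA hB, fun θ => ?_⟩
  rw [map_mul, ← hA', ← hB']
  ring

theorem IsTrigPoly.add {d : ℕ} {h k : ℝ → ℂ} (hh : IsTrigPoly d h) (hk : IsTrigPoly d k) :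
    IsTrigPoly d (fun θ => h θ + k θ) := by
  obtain ⟨A, hA, hA'⟩ := hh
  obtain ⟨B, hB, hB'⟩ := hk
  refine ⟨A + B, natDegree_add_le_of_degree_le hA hB, fun θ => ?_⟩
  rw [map_add, ← hA', ← hB']
  ring

theorem IsTrigPoly.const_mul {d : ℕ} {h : ℝ → ℂ} (hh : IsTrigPoly d h) (c : ℝ) :
    IsTrigPoly d (fun θ => c * h θ) := by
  obtain ⟨A, hA, hA'⟩ := hh
  refine ⟨C c * A, (natDegree_C_mul_le c A).trans hA, fun θ => ?_⟩
  rw [map_mul, ← hA', aeval_C, Complex.coe_algebraMap]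
  ring

theorem isTrigPoly_const (c : ℝ) : IsTrigPoly 0 (fun _ => (c : ℂ)) :=
  ⟨C c, by simp, fun θ => by simp⟩

theorem isTrigPoly_exp : IsTrigPoly 1 (fun θ => exp (θ * I)) :=
  ⟨X, natDegree_X_le, fun θ => by rw [aeval_X]; ring⟩

theorem isTrigPoly_exp_neg : IsTrigPoly 1 (fun θ => exp (-(θ * I))) :=
  ⟨1, by simp, fun θ => by rw [map_one, pow_one, ← exp_add]; simp⟩

theorem isTrigPoly_cos : IsTrigPoly 1 (fun θ => (Real.cos θ : ℂ)) := by
  convert (isTrigPoly_exp.add isTrigPoly_exp_neg).const_mul (1 / 2) using 2 with θ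
  rw [ofReal_cos, Complex.cos]
  push_cast
  ring_nf

/-- The factor i makes the coefficients real: i sin θ = (e^{iθ} - e^{-iθ}) / 2. -/
theorem isTrigPoly_sin : IsTrigPoly 1 (fun θ => I * (Real.sin θ : ℂ)) := by
  convert (isTrigPoly_exp.add (isTrigPoly_exp_neg.const_mul (-1))).const_mul (1 / 2) using 2 with θ
  rw [ofReal_sin, Complex.sin]
  push_cast
  ring_nf
  rw [I_sq]
  ring_nf

/-- Pads the degree by any k, of either parity, without changing the modulus. -/
theorem IsTrigPoly.mul_exp_pow {d : ℕ} {h : ℝ → ℂ} (hh : IsTrigPoly d h) (k : ℕ) :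
    IsTrigPoly (d + k) (fun θ => h θ * exp (θ * I) ^ k) := by
  induction k with
  | zero => simpa using hh
  | succ k ih =>
    have := ih.mul isTrigPoly_exp
    simpa only [pow_succ, mul_assoc, add_assoc] using this

theorem IsTrigPoly.add_two {d : ℕ} {h : ℝ → ℂ} (hh : IsTrigPoly d h) : IsTrigPoly (d + 2) h := by
  convert (hh.mul isTrigPoly_exp).mul isTrigPoly_exp_neg using 2 with θ
  rw [mul_assoc, ← exp_add]
  simp

theorem IsTrigPoly.add_two_mul {d : ℕ} {h : ℝ → ℂ} (hh : IsTrigPoly d h) (k : ℕ) :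
    IsTrigPoly (d + 2 * k) h := by
  induction k with
  | zero => exact hh
  | succ k ih => exact ih.add_two

theorem isTrigPoly_eval_cos_sq (a : ℝ[X]) :
    IsTrigPoly (2 * a.natDegree) (fun θ => ((a.eval (Real.cos θ ^ 2) : ℝ) : ℂ)) := by
  suffices h : ∀ n : ℕ, ∀ a : ℝ[X], a.natDegree ≤ n →
      IsTrigPoly (2 * n) (fun θ => ((a.eval (Real.cos θ ^ 2) : ℝ) : ℂ)) from h _ a le_rfl
  intro n
  induction n with
  | zero =>
    intro a ha
    rw [eq_C_of_natDegree_le_zero ha]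
    simpa using isTrigPoly_const (a.coeff 0)
  | succ n ih =>
    intro a ha
    -- Horner's scheme: a(y) = y · `a.divX`(y) + a(0), with y = cos² θ.
    have h1 := ((ih a.divX (by rw [natDegree_divX_eq_natDegree_tsub_one]; omega)).mul
      (isTrigPoly_cos.mul isTrigPoly_cos)).add
      ((isTrigPoly_const (a.coeff 0)).add_two_mul (n + 1) |> fun h => by simpa [mul_add] using h)
    have h2 : 2 * (n + 1) = 2 * n + (1 + 1) := by ring
    rw [h2]
    convert h1 using 2 with θ
    conv_lhs => rw [← divX_mul_X_add a]
    simp only [eval_add, eval_mul, eval_X, eval_C]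
    push_cast
    ring

/-! ### Spectral factorization -/

theorem normSq_add_I_mul (a b : ℝ) : normSq (a + I * b) = a ^ 2 + b ^ 2 := by
  rw [mul_comm, normSq_add_mul_I]

/-- Take G = √α cos θ + i √β sin θ. -/
theorem exists_isTrigPoly_normSq_linear {α β : ℝ} (hα : 0 ≤ α) (hβ : 0 ≤ β) :
    ∃ G, IsTrigPoly 1 G ∧
      ∀ θ : ℝ, normSq (G θ) = α * Real.cos θ ^ 2 + β * (1 - Real.cos θ ^ 2) := by
  refine ⟨_, (isTrigPoly_cos.const_mul √α).add (isTrigPoly_sin.const_mul √β), fun θ => ?_⟩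
  have := normSq_add_I_mul (√α * Real.cos θ) (√β * Real.sin θ)
  push_cast at this
  rw [mul_left_comm I] at this
  push_cast
  rw [this, mul_pow, mul_pow, Real.sq_sqrt hα, Real.sq_sqrt hβ, ← Real.sin_sq]

/-- With y = cos² θ and G = a - (a + c) y + i s cos θ sin θ, the squared modulus is (a - (a + c) y)²
+ s² y (1 - y). The values at y = 0 and y = 1 force a = |z| and c = |1 - z| for z = u + iv; the
leading coefficient forces s² = (a + c)² - 1, which is nonnegative by the triangle inequality. -/
theorem exists_isTrigPoly_normSq_quadratic (u v : ℝ) :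
    ∃ G, IsTrigPoly 2 G ∧
      ∀ θ : ℝ, normSq (G θ) = (Real.cos θ ^ 2 - u) ^ 2 + v ^ 2 := by
  set a := √(u ^ 2 + v ^ 2) with ha
  set c := √((1 - u) ^ 2 + v ^ 2) with hc
  have ha2 : a ^ 2 = u ^ 2 + v ^ 2 := Real.sq_sqrt (by positivity)
  have hc2 : c ^ 2 = (1 - u) ^ 2 + v ^ 2 := Real.sq_sqrt (by positivity)
  have hau : u ≤ a := Real.le_sqrt_of_sq_le (by nlinarith)
  have hcu : 1 - u ≤ c := Real.le_sqrt_of_sq_le (by nlinarith)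
  have hb : 0 ≤ (a + c) ^ 2 - 1 := by nlinarith
  set s := √((a + c) ^ 2 - 1) with hs
  have hs2 : s ^ 2 = (a + c) ^ 2 - 1 := Real.sq_sqrt hb
  refine ⟨_, ((isTrigPoly_const a).add_two.add
    ((isTrigPoly_cos.mul isTrigPoly_cos).const_mul (-(a + c)))).add
    ((isTrigPoly_cos.mul isTrigPoly_sin).const_mul s), fun θ => ?_⟩
  have h := normSq_add_I_mul (a + (-(a + c)) * (Real.cos θ * Real.cos θ))
    (s * (Real.cos θ * Real.sin θ))
  have h2 : (a : ℂ) + ((-(a + c) : ℝ) : ℂ) * (Real.cos θ * Real.cos θ) +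
      s * (Real.cos θ * (I * Real.sin θ)) =
      ((a + (-(a + c)) * (Real.cos θ * Real.cos θ) : ℝ) : ℂ) +
        I * ((s * (Real.cos θ * Real.sin θ) : ℝ) : ℂ) := by
    push_cast
    ring
  rw [h2, h, mul_pow, mul_pow, hs2, Real.sin_sq]
  linear_combination (1 - Real.cos θ ^ 2) * ha2 + Real.cos θ ^ 2 * hc2

theorem exists_isTrigPoly_normSq_natDegree (r : ℝ[X]) (hr : ∀ y ∈ Set.Icc (0 : ℝ) 1, 0 < r.eval y) :
    ∃ G, IsTrigPoly r.natDegree G ∧ ∀ θ : ℝ, normSq (G θ) = r.eval (Real.cos θ ^ 2) := by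
  induction hn : r.natDegree using Nat.strong_induction_on generalizing r with
  | _ n ih =>
  rcases Nat.eq_zero_or_pos n with h0 | hpos
  · subst h0
    rw [eq_C_of_natDegree_eq_zero hn] at hr ⊢
    refine ⟨_, isTrigPoly_const √(r.coeff 0), fun θ => ?_⟩
    have := hr 0 (by simp)
    simp only [eval_C] at this ⊢
    rw [normSq_ofReal, Real.mul_self_sqrt this.le]
  have hr0 : r ≠ 0 := by rintro rfl; simp at hn; omega
  -- Splits off a factor l that is positive on [0, 1]: the cofactor is positive there too, and
  -- spectral factors multiply.
  have key : ∀ l q : ℝ[X], 0 < l.natDegree → r = l * q → (∀ y ∈ Set.Icc (0 : ℝ) 1, 0 < l.eval y) →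
      (∃ G, IsTrigPoly l.natDegree G ∧ ∀ θ : ℝ, normSq (G θ) = l.eval (Real.cos θ ^ 2)) →
      ∃ G, IsTrigPoly n G ∧ ∀ θ : ℝ, normSq (G θ) = r.eval (Real.cos θ ^ 2) := by
    rintro l q hl rfl hlpos ⟨G, hG, hG'⟩
    have hdeg : (l * q).natDegree = l.natDegree + q.natDegree :=
      natDegree_mul (left_ne_zero_of_mul hr0) (right_ne_zero_of_mul hr0)
    obtain ⟨K, hK, hK'⟩ := ih q.natDegree (by omega) q (fun y hy => by
      have h1 := hr y hy
      rw [eval_mul] at h1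
      exact pos_of_mul_pos_right h1 (hlpos y hy).le) rfl
    refine ⟨_, (by rw [← hn, hdeg]; exact hG.mul hK), fun θ => ?_⟩
    rw [normSq_mul, hG', hK', eval_mul]
  obtain ⟨z, hz⟩ := Complex.exists_root (f := r.map (algebraMap ℝ ℂ)) (by
    rw [degree_map, degree_eq_natDegree hr0]; exact_mod_cast hn ▸ hpos)
  have hz' : aeval z r = 0 := by rwa [IsRoot.def, eval_map_algebraMap] at hz
  by_cases him : z.im = 0
  · have hzre : z = (z.re : ℂ) := Complex.ext rfl (by simp [him])
    have hroot : r.IsRoot z.re := by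
      rw [hzre, ← Complex.coe_algebraMap, aeval_algebraMap_apply] at hz'
      simpa using hz'
    obtain ⟨q, hq⟩ := dvd_iff_isRoot.2 hroot
    have hnot : z.re ∉ Set.Icc (0 : ℝ) 1 := fun h => (hr _ h).ne' hroot
    rcases lt_or_ge z.re 0 with hneg | hnn
    · refine key (X - C z.re) q (by simp) hq (fun y hy => by simp; linarith [hy.1]) ?_
      -- α and β are the values of the linear factor at y = 1 and y = 0.
      obtain ⟨G, hG, hG'⟩ := exists_isTrigPoly_normSq_linear (α := 1 - z.re) (β := -z.re)
        (by linarith) (by linarith)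
      refine ⟨G, by simpa using hG, fun θ => ?_⟩
      rw [hG']
      simp
      ring
    · have hgt : 1 < z.re := by
        by_contra h
        exact hnot ⟨hnn, not_lt.1 h⟩
      refine key (-(X - C z.re)) (-q) (by rw [natDegree_neg]; simp) (by rw [hq]; ring)
        (fun y hy => by simp; linarith [hy.2]) ?_
      obtain ⟨G, hG, hG'⟩ := exists_isTrigPoly_normSq_linear (α := z.re - 1) (β := z.re)
        (by linarith) (by linarith)
      refine ⟨G, by rw [natDegree_neg]; simpa using hG, fun θ => ?_⟩
      rw [hG']
      simp
      ring
  · obtain ⟨q, hq⟩ := quadratic_dvd_of_aeval_eq_zero_im_ne_zero r hz' him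
    have heval : ∀ y : ℝ, (X ^ 2 - C (2 * z.re) * X + C (‖z‖ ^ 2)).eval y =
        (y - z.re) ^ 2 + z.im ^ 2 := fun y => by
      rw [Complex.sq_norm, normSq_apply]
      simp
      ring
    have hdeg : (X ^ 2 - C (2 * z.re) * X + C (‖z‖ ^ 2)).natDegree = 2 := by
      compute_degree!
    refine key _ q (by omega) hq (fun y _ => by rw [heval]; positivity) ?_
    rw [hdeg]
    obtain ⟨G, hG, hG'⟩ := exists_isTrigPoly_normSq_quadratic z.re z.im
    exact ⟨G, hG, fun θ => by rw [hG', heval]⟩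

/-- A polynomial that is positive on `[0, 1]` is, in the variable `cos² θ`, the squared modulus of
a trigonometric polynomial with real coefficients. -/
theorem exists_isTrigPoly_normSq {d : ℕ} (r : ℝ[X]) (hd : r.natDegree ≤ d)
    (hr : ∀ y ∈ Set.Icc (0 : ℝ) 1, 0 < r.eval y) :
    ∃ G, IsTrigPoly d G ∧ ∀ θ : ℝ, normSq (G θ) = r.eval (Real.cos θ ^ 2) := by
  obtain ⟨G, hG, hG'⟩ := exists_isTrigPoly_normSq_natDegree r hr
  refine ⟨_, by simpa only [Nat.add_sub_cancel' hd] using hG.mul_exp_pow (d - r.natDegree),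
    fun θ => ?_⟩
  rw [normSq_mul, hG', ← Complex.sq_norm, norm_pow, norm_exp_ofReal_mul_I]
  simp

end SymmetricQSP

namespace SymmetricQSP

open Polynomial Complex
open QSP (Op phase signal protocol reversal IsSymmetric)

/-! ### Symmetric protocols as matrix functions of the angle -/

/-- `e^{iθσ_x}`. -/
noncomputable def rotX (θ : ℝ) : Op :=
  !![(Real.cos θ : ℂ), I * (Real.sin θ : ℂ); I * (Real.sin θ : ℂ), (Real.cos θ : ℂ)]

/-- `i f σ_z + Re G + i Im G σ_x`. -/
noncomputable def symMatrix (f : ℝ) (G : ℂ) : Op :=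
  !![(G.re : ℂ) + I * f, I * G.im; I * G.im, (G.re : ℂ) - I * f]

/-- The matrix functions of the angle `θ` that symmetric phases produce. -/
inductive IsSymmetricProtocol : (ℝ → Op) → Prop
  | phase (φ : ℝ) : IsSymmetricProtocol (fun _ => phase φ)
  | signal (φ : ℝ) : IsSymmetricProtocol (fun θ => phase φ * rotX θ * phase φ)
  | step (φ : ℝ) {M : ℝ → Op} : IsSymmetricProtocol M →
      IsSymmetricProtocol (fun θ => phase φ * rotX θ * M θ * rotX θ * phase φ)

theorem phase_mul_phase (φ ψ : ℝ) : phase φ * phase ψ = phase (φ + ψ) := by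
  simp only [phase, Matrix.mul_fin_two, mul_zero, zero_mul, add_zero, zero_add, ← exp_add]
  push_cast
  ring_nf

theorem phase_zero : phase 0 = 1 := by
  ext i j
  fin_cases i <;> fin_cases j <;> simp [phase]

/-- The new phases merge with the outermost ones, so no layer is added. -/
theorem IsSymmetricProtocol.rotate {M : ℝ → Op} (hM : IsSymmetricProtocol M) (φ : ℝ) :
    IsSymmetricProtocol (fun θ => QSP.phase φ * M θ * QSP.phase φ) := by
  have hl : ∀ ψ, QSP.phase φ * QSP.phase ψ = QSP.phase (φ + ψ) := phase_mul_phase φ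
  have hr : ∀ ψ, QSP.phase ψ * QSP.phase φ = QSP.phase (φ + ψ) := fun ψ => by
    rw [phase_mul_phase, add_comm]
  cases hM with
  | phase ψ =>
    convert IsSymmetricProtocol.phase (φ + ψ + φ) using 2
    rw [phase_mul_phase, phase_mul_phase]
  | signal ψ =>
    convert IsSymmetricProtocol.signal (φ + ψ) using 2
    simp only [mul_assoc, hr]
    rw [← mul_assoc, hl]
  | step ψ hM =>
    convert IsSymmetricProtocol.step (φ + ψ) hM using 2
    simp only [mul_assoc, hr]
    rw [← mul_assoc, hl]

theorem IsSymmetricProtocol.conj {M : ℝ → Op} (hM : IsSymmetricProtocol M) :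
    IsSymmetricProtocol (fun θ => rotX θ * M θ * rotX θ) := by
  simpa [phase_zero] using IsSymmetricProtocol.step 0 hM

theorem exp_I_mul_ofReal (φ : ℝ) : exp (I * φ) = Real.cos φ + Real.sin φ * I := by
  rw [mul_comm, exp_mul_I, ofReal_cos, ofReal_sin]

theorem exp_neg_I_mul_ofReal (φ : ℝ) : exp (-(I * φ)) = Real.cos φ - Real.sin φ * I := by
  have h : -(I * (φ : ℂ)) = I * ((-φ : ℝ) : ℂ) := by push_cast; ring
  rw [h, exp_I_mul_ofReal, Real.cos_neg, Real.sin_neg]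
  push_cast
  ring

/-- On the vector (f, Re G, Im G), a phase on both sides rotates the first two coordinates through
2φ; a signal on both sides rotates the last two through 2θ. -/
theorem phase_mul_symMatrix_mul_phase (φ f : ℝ) (G : ℂ) :
    phase φ * symMatrix f G * phase φ =
      symMatrix (f * Real.cos (2 * φ) + G.re * Real.sin (2 * φ))
        ((G.re * Real.cos (2 * φ) - f * Real.sin (2 * φ) : ℝ) + G.im * I) := by
  have hsc : (Real.cos φ : ℂ) ^ 2 + (Real.sin φ : ℂ) ^ 2 = 1 := by
    exact_mod_cast Real.cos_sq_add_sin_sq φ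
  have h2 : (Real.cos (2 * φ) : ℂ) = (Real.cos φ : ℂ) ^ 2 - (Real.sin φ : ℂ) ^ 2 := by
    rw [Real.cos_two_mul']; push_cast; ring
  simp only [phase, symMatrix, Matrix.mul_fin_two, exp_I_mul_ofReal, exp_neg_I_mul_ofReal,
    Real.sin_two_mul, add_re, add_im, ofReal_re, ofReal_im, mul_re, mul_im, I_re, I_im]
  generalize Real.cos (2 * φ) = u at *
  ext i j
  fin_cases i <;> fin_cases j <;> simp <;> simp only [← ofReal_cos, ← ofReal_sin]
  · rw [h2]
    linear_combination (G.re * Real.sin φ ^ 2 + I * f * Real.sin φ ^ 2 +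
      2 * f * Real.cos φ * Real.sin φ : ℂ) * I_sq
  · linear_combination (I * G.im : ℂ) * hsc - I * G.im * Real.sin φ ^ 2 * I_sq
  · linear_combination (I * G.im : ℂ) * hsc - I * G.im * Real.sin φ ^ 2 * I_sq
  · rw [h2]
    linear_combination (G.re * Real.sin φ ^ 2 - I * f * Real.sin φ ^ 2 +
      2 * f * Real.cos φ * Real.sin φ : ℂ) * I_sq

theorem rotX_mul_symMatrix_mul_rotX (θ f : ℝ) (G : ℂ) :
    rotX θ * symMatrix f G * rotX θ = symMatrix f (G * exp (θ * I) ^ 2) := by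
  have hsc : (Real.cos θ : ℂ) ^ 2 + (Real.sin θ : ℂ) ^ 2 = 1 := by
    exact_mod_cast Real.cos_sq_add_sin_sq θ
  have hG : G * exp (θ * I) ^ 2 = ((G.re * (Real.cos θ ^ 2 - Real.sin θ ^ 2) -
      G.im * (2 * Real.cos θ * Real.sin θ) : ℝ) : ℂ) + (G.im * (Real.cos θ ^ 2 - Real.sin θ ^ 2) +
      G.re * (2 * Real.cos θ * Real.sin θ) : ℝ) * I := by
    conv_lhs => rw [← re_add_im G, exp_mul_I, ← ofReal_cos, ← ofReal_sin]
    push_cast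
    simp only [← ofReal_cos, ← ofReal_sin]
    linear_combination ((G.re + G.im * I) * Real.sin θ ^ 2 +
      2 * G.im * Real.cos θ * Real.sin θ : ℂ) * I_sq
  rw [hG]
  simp only [rotX, symMatrix, Matrix.mul_fin_two, add_re, add_im, ofReal_re, ofReal_im, mul_re,
    mul_im, I_re, I_im]
  ext i j
  fin_cases i <;> fin_cases j <;> simp <;> simp only [← ofReal_cos, ← ofReal_sin]
  · linear_combination (I * f : ℂ) * hsc + (G.re * Real.sin θ ^ 2 +
      2 * G.im * Real.cos θ * Real.sin θ - I * f * Real.sin θ ^ 2 : ℂ) * I_sq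
  · linear_combination (I * G.im * Real.sin θ ^ 2 : ℂ) * I_sq
  · linear_combination (I * G.im * Real.sin θ ^ 2 : ℂ) * I_sq
  · linear_combination (-I * f : ℂ) * hsc + (G.re * Real.sin θ ^ 2 +
      2 * G.im * Real.cos θ * Real.sin θ + I * f * Real.sin θ ^ 2 : ℂ) * I_sq

theorem isSymmetricProtocol_symMatrix_rotate {f : ℝ → ℝ} {G : ℝ → ℂ} (φ : ℝ)
    (h : IsSymmetricProtocol (fun θ => symMatrix
      (f θ * Real.cos (2 * φ) + (G θ).re * Real.sin (2 * φ))
      (((G θ).re * Real.cos (2 * φ) - f θ * Real.sin (2 * φ) : ℝ) + (G θ).im * I))) :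
    IsSymmetricProtocol (fun θ => symMatrix (f θ) (G θ)) := by
  convert h.rotate (-φ) using 2 with θ
  rw [← phase_mul_symMatrix_mul_phase]
  simp only [← mul_assoc, phase_mul_phase, neg_add_cancel, phase_zero, one_mul]
  simp only [mul_assoc, phase_mul_phase, add_neg_cancel, phase_zero, mul_one]

theorem isSymmetricProtocol_symMatrix_mul_exp_sq {f : ℝ → ℝ} {G : ℝ → ℂ}
    (h : IsSymmetricProtocol (fun θ => symMatrix (f θ) (G θ))) :
    IsSymmetricProtocol (fun θ => symMatrix (f θ) (G θ * exp (θ * I) ^ 2)) := by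
  simpa only [rotX_mul_symMatrix_mul_rotX] using h.conj

theorem isSymmetricProtocol_symMatrix_negate {f : ℝ → ℝ} {G : ℝ → ℂ}
    (h : IsSymmetricProtocol (fun θ => symMatrix (f θ) (G θ))) :
    IsSymmetricProtocol (fun θ => symMatrix (-f θ) (-star (G θ))) := by
  convert h.rotate (Real.pi / 2) using 2 with θ
  rw [phase_mul_symMatrix_mul_phase, mul_div_cancel₀ _ two_ne_zero, Real.cos_pi, Real.sin_pi]
  congr 1
  · simp
  · apply Complex.ext <;> simp

/-- Phases π/2 on both sides send G to minus its conjugate. Between two such moves, multiplication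
by e^{2iθ} becomes multiplication by e^{-2iθ}, so a layer can be undone. -/
theorem isSymmetricProtocol_symMatrix_of_mul_exp_sq {f : ℝ → ℝ} {G : ℝ → ℂ}
    (h : IsSymmetricProtocol (fun θ => symMatrix (f θ) (G θ * exp (θ * I) ^ 2))) :
    IsSymmetricProtocol (fun θ => symMatrix (f θ) (G θ)) := by
  convert isSymmetricProtocol_symMatrix_negate (isSymmetricProtocol_symMatrix_mul_exp_sq
    (isSymmetricProtocol_symMatrix_negate h)) using 2 with θ
  have h1 : star (exp (θ * I)) * exp (θ * I) = 1 := by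
    rw [star_def, ← exp_conj, ← exp_add]
    simp
  congr 1
  · simp
  · simp only [star_mul', star_neg, star_pow, star_star, neg_mul, neg_neg]
    rw [mul_assoc, ← mul_pow, mul_comm (exp _), h1]
    simp

/-- The pairs with f = 0 and G = ±1 or ±e^{±iθ} are where layer stripping ends, in degrees 0 and 1.
-/
theorem isSymmetricProtocol_symMatrix_one : IsSymmetricProtocol (fun _ => symMatrix 0 1) := by
  convert IsSymmetricProtocol.phase 0 using 2
  rw [phase_zero]
  ext i j
  fin_cases i <;> fin_cases j <;> simp [symMatrix]

theorem isSymmetricProtocol_symMatrix_neg_one :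
    IsSymmetricProtocol (fun _ => symMatrix 0 (-1)) := by
  simpa using isSymmetricProtocol_symMatrix_negate isSymmetricProtocol_symMatrix_one

theorem isSymmetricProtocol_symMatrix_exp :
    IsSymmetricProtocol (fun θ => symMatrix 0 (exp (θ * I))) := by
  convert IsSymmetricProtocol.signal 0 using 2 with θ
  rw [phase_zero, one_mul, mul_one, symMatrix, rotX, exp_ofReal_mul_I_re, exp_ofReal_mul_I_im]
  simp

theorem star_exp_ofReal_mul_I (θ : ℝ) : star (exp (θ * I)) = exp (-(θ * I)) := by
  rw [star_def, ← exp_conj]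
  simp

theorem isSymmetricProtocol_symMatrix_neg_exp_neg :
    IsSymmetricProtocol (fun θ => symMatrix 0 (-exp (-(θ * I)))) := by
  simpa only [neg_zero, star_exp_ofReal_mul_I] using
    isSymmetricProtocol_symMatrix_negate isSymmetricProtocol_symMatrix_exp

theorem isSymmetricProtocol_symMatrix_neg_exp :
    IsSymmetricProtocol (fun θ => symMatrix 0 (-exp (θ * I))) := by
  convert isSymmetricProtocol_symMatrix_mul_exp_sq isSymmetricProtocol_symMatrix_neg_exp_neg
    using 3 with θ
  rw [← exp_nat_mul, neg_mul, ← exp_add]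
  push_cast
  ring_nf

theorem isSymmetricProtocol_symMatrix_exp_neg :
    IsSymmetricProtocol (fun θ => symMatrix 0 (exp (-(θ * I)))) := by
  have := isSymmetricProtocol_symMatrix_negate isSymmetricProtocol_symMatrix_neg_exp
  simpa only [neg_zero, star_neg, neg_neg, star_exp_ofReal_mul_I] using this

/-! ### Lists of phases -/

theorem protocol_cons {n : ℕ} (φ : ℝ) (Φ : Fin (n + 1) → ℝ) (x : ℝ) :
    protocol (Fin.cons φ Φ : Fin (n + 2) → ℝ) x = phase φ * signal x * protocol Φ x := by
  simp [protocol, List.ofFn_succ, mul_assoc]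

theorem protocol_snoc {n : ℕ} (Φ : Fin (n + 1) → ℝ) (φ : ℝ) (x : ℝ) :
    protocol (Fin.snoc Φ φ : Fin (n + 2) → ℝ) x = protocol Φ x * signal x * phase φ := by
  rw [protocol, List.ofFn_succ', List.concat_eq_append, List.prod_append, List.prod_singleton,
    protocol]
  have h0 : (Fin.snoc Φ φ : Fin (n + 2) → ℝ) 0 = Φ 0 :=
    Fin.snoc_castSucc (α := fun _ => ℝ) φ Φ 0
  have h1 : (Fin.snoc Φ φ : Fin (n + 2) → ℝ) (Fin.last n).succ = φ := by
    rw [Fin.succ_last]; exact Fin.snoc_last (α := fun _ => ℝ) φ Φ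
  have h2 : ∀ j : Fin n, (Fin.snoc Φ φ : Fin (n + 2) → ℝ) j.castSucc.succ = Φ j.succ := fun j => by
    rw [Fin.succ_castSucc]; exact Fin.snoc_castSucc (α := fun _ => ℝ) φ Φ j.succ
  simp only [h0, h1, h2, mul_assoc]

theorem isSymmetric_cons_snoc {n : ℕ} {Φ : Fin (n + 1) → ℝ} (hΦ : IsSymmetric Φ) (φ : ℝ) :
    IsSymmetric (Fin.cons φ (Fin.snoc Φ φ : Fin (n + 2) → ℝ) : Fin (n + 3) → ℝ) := by
  funext j
  unfold reversal
  refine Fin.cases ?_ (fun j => ?_) j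
  · rw [Fin.rev_zero, ← Fin.succ_last, Fin.cons_succ, Fin.cons_zero]
    exact Fin.snoc_last (α := fun _ => ℝ) φ Φ
  · refine Fin.lastCases ?_ (fun k => ?_) j
    · rw [Fin.succ_last, Fin.rev_last, Fin.cons_zero, ← Fin.succ_last, Fin.cons_succ]
      exact (Fin.snoc_last (α := fun _ => ℝ) φ Φ).symm
    · rw [Fin.rev_succ, Fin.rev_castSucc, Fin.castSucc_succ, Fin.cons_succ, Fin.cons_succ]
      refine (Fin.snoc_castSucc (α := fun _ => ℝ) φ Φ _).trans
        (Eq.trans ?_ (Fin.snoc_castSucc (α := fun _ => ℝ) φ Φ _).symm)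
      exact congrFun hΦ k

theorem IsSymmetricProtocol.exists_protocol_eq {M : ℝ → Op} (hM : IsSymmetricProtocol M) :
    ∃ (n : ℕ) (Φ : Fin (n + 1) → ℝ), IsSymmetric Φ ∧
      ∀ x ∈ Set.Icc (-1 : ℝ) 1, protocol Φ x = M (Real.arccos x) := by
  have hW : ∀ x ∈ Set.Icc (-1 : ℝ) 1, rotX (Real.arccos x) = QSP.signal x := fun x hx => by
    rw [rotX, QSP.signal, Real.cos_arccos hx.1 hx.2, Real.sin_arccos]
  induction hM with
  | phase φ => exact ⟨0, fun _ => φ, rfl, fun x _ => by simp [protocol]⟩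
  | signal φ =>
    refine ⟨1, fun _ => φ, rfl, fun x hx => ?_⟩
    simp [protocol, hW x hx, mul_assoc]
  | step φ _ ih =>
    obtain ⟨n, Φ, hΦ, h⟩ := ih
    refine ⟨n + 2, _, isSymmetric_cons_snoc hΦ φ, fun x hx => ?_⟩
    rw [protocol_cons, protocol_snoc, h x hx, ← hW x hx]
    simp only [mul_assoc]

end SymmetricQSP

/-! ### Layer stripping -/

namespace SymmetricQSP

open Polynomial Complex

theorem exp_mul_exp_neg_ofReal_mul_I (θ : ℝ) : exp (θ * I) * exp (-(θ * I)) = 1 := by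
  rw [← exp_add]
  simp

theorem eq_of_aeval_exp_sq {A B : ℝ[X]}
    (h : ∀ θ : ℝ, aeval (exp (θ * I) ^ 2) A = aeval (exp (θ * I) ^ 2) B) : A = B := by
  apply map_injective (algebraMap ℝ ℂ) (algebraMap ℝ ℂ).injective
  apply eq_of_infinite_eval_eq
  -- For θ in (0, 1) the angle 2θ stays below π, so the points e^{2iθ} are distinct.
  have hinj : Set.InjOn (fun θ : ℝ => exp (θ * I) ^ 2) (Set.Ioo 0 1) := by
    intro a ha b hb hab
    have hpi := Real.pi_gt_three
    simp only [← exp_nat_mul] at hab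
    have := exp_inj_of_neg_pi_lt_of_le_pi (by simp; linarith [ha.1]) (by simp; linarith [ha.2])
      (by simp; linarith [hb.1]) (by simp; linarith [hb.2]) hab
    simpa using this
  refine ((Set.Ioo_infinite (zero_lt_one' ℝ)).image hinj).mono ?_
  rintro _ ⟨θ, -, rfl⟩
  simpa [eval_map_algebraMap] using h θ

/-- Real coefficients on the unit circle: conjugation swaps the frequencies k and -k, which reverses
the coefficient list. -/
theorem aeval_reflect {d : ℕ} {A : ℝ[X]} (hd : A.natDegree ≤ d) {h : ℝ → ℂ}
    (hA : ∀ θ : ℝ, exp (θ * I) ^ d * h θ = aeval (exp (θ * I) ^ 2) A) (θ : ℝ) :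
    exp (θ * I) ^ d * star (h θ) = aeval (exp (θ * I) ^ 2) (reflect d A) := by
  have he := exp_mul_exp_neg_ofReal_mul_I θ
  let _ : Invertible (exp (-(θ * I)) ^ 2) :=
    ⟨exp (θ * I) ^ 2, by rw [← mul_pow, he, one_pow], by rw [← mul_pow, mul_comm, he, one_pow]⟩
  have h1 : aeval (exp (θ * I) ^ 2) (reflect d A) * (exp (-(θ * I)) ^ 2) ^ d =
      aeval (exp (-(θ * I)) ^ 2) A :=
    eval₂_reflect_mul_pow (algebraMap ℝ ℂ) (exp (-(θ * I)) ^ 2) d A hd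
  have h2 : aeval (exp (-(θ * I)) ^ 2) A = exp (-(θ * I)) ^ d * star (h θ) := by
    have h3 := congrArg star (hA θ)
    rw [star_mul', star_pow, star_exp_ofReal_mul_I] at h3
    rw [h3, star_def, ← aeval_conj, map_pow, ← star_def, star_exp_ofReal_mul_I]
  have h4 : exp (θ * I) ^ d * exp (-(θ * I)) ^ d = 1 := by rw [← mul_pow, he, one_pow]
  rw [h2] at h1
  linear_combination (-(exp (θ * I) ^ d) ^ 2) * h1 +
    (aeval (exp (θ * I) ^ 2) (reflect d A) * (exp (θ * I) ^ d * exp (-(θ * I)) ^ d + 1) -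
      star (h θ) * exp (θ * I) ^ d) * h4

theorem exists_phase_eliminating (a b : ℝ) :
    ∃ φ : ℝ, a * Real.cos (2 * φ) + b * Real.sin (2 * φ) = 0 := by
  refine ⟨-arg (b + a * I) / 2, ?_⟩
  have h1 := norm_mul_cos_arg (b + a * I)
  have h2 := norm_mul_sin_arg (b + a * I)
  simp only [add_re, add_im, ofReal_re, ofReal_im, mul_re, mul_im, I_re, I_im] at h1 h2
  rw [mul_div_cancel₀ _ two_ne_zero, Real.cos_neg, Real.sin_neg]
  linear_combination Real.cos (arg (b + a * I)) * (-h2) + Real.sin (arg (b + a * I)) * h1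

theorem reflect_eq_self_of_ofReal {d : ℕ} {F : ℝ[X]} (hF : F.natDegree ≤ d) {f : ℝ → ℝ}
    (hFf : ∀ θ : ℝ, exp (θ * I) ^ d * f θ = aeval (exp (θ * I) ^ 2) F) : reflect d F = F :=
  eq_of_aeval_exp_sq fun θ => by
    rw [← aeval_reflect hF (h := fun θ => f θ) hFf θ, ← hFf θ, star_def, conj_ofReal]

/-- The normalization, turned into a polynomial identity whose coefficients can be compared. -/
theorem sq_add_mul_reflect {d : ℕ} {F A : ℝ[X]} (hA : A.natDegree ≤ d)
    {f : ℝ → ℝ} {G : ℝ → ℂ}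
    (hFf : ∀ θ : ℝ, exp (θ * I) ^ d * f θ = aeval (exp (θ * I) ^ 2) F)
    (hAG : ∀ θ : ℝ, exp (θ * I) ^ d * G θ = aeval (exp (θ * I) ^ 2) A)
    (hfG : ∀ θ, f θ ^ 2 + normSq (G θ) = 1) : F * F + A * reflect d A = X ^ d := by
  refine eq_of_aeval_exp_sq fun θ => ?_
  have h1 : (f θ : ℂ) ^ 2 + G θ * star (G θ) = 1 := by
    rw [star_def, mul_conj]
    exact_mod_cast hfG θ
  rw [map_add, map_mul, map_mul, ← hFf, ← hAG, ← aeval_reflect hA hAG, map_pow, aeval_X]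
  linear_combination (exp (θ * I) ^ d) ^ 2 * h1

/-- At degree bound d + 2, coefficient k of A belongs to frequency 2k - (d + 2). Losing both extreme
frequencies lowers the bound by 2; losing two at one end does so after a shift by e^{±2iθ}, as in
the next two lemmas. -/
theorem isTrigPoly_of_coeff_zero {d : ℕ} {A : ℝ[X]} {G : ℝ → ℂ} (hA : A.natDegree ≤ d + 2)
    (hAG : ∀ θ : ℝ, exp (θ * I) ^ (d + 2) * G θ = aeval (exp (θ * I) ^ 2) A)
    (h0 : A.coeff 0 = 0) (h1 : A.coeff (d + 2) = 0) : IsTrigPoly d G := by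
  refine ⟨A.divX, ?_, fun θ => ?_⟩
  · rw [natDegree_le_iff_coeff_eq_zero]
    intro N hN
    rw [coeff_divX]
    rcases eq_or_lt_of_le (Nat.succ_le_of_lt hN) with h | h
    · rw [← h, h1]
    · exact coeff_eq_zero_of_natDegree_lt (by omega)
  · have h := hAG θ
    rw [← divX_mul_X_add A, h0, C_0, add_zero, map_mul, aeval_X] at h
    refine mul_right_cancel₀ (pow_ne_zero 2 (exp_ne_zero (θ * I))) ?_
    rw [← h]
    ring

theorem isTrigPoly_mul_exp_sq_of_coeff {d : ℕ} {A : ℝ[X]} {G : ℝ → ℂ} (hA : A.natDegree ≤ d + 2)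
    (hAG : ∀ θ : ℝ, exp (θ * I) ^ (d + 2) * G θ = aeval (exp (θ * I) ^ 2) A)
    (h0 : A.coeff (d + 1) = 0) (h1 : A.coeff (d + 2) = 0) :
    IsTrigPoly d (fun θ => G θ * exp (θ * I) ^ 2) := by
  refine ⟨A, ?_, fun θ => ?_⟩
  · rw [natDegree_le_iff_coeff_eq_zero]
    intro N hN
    rcases eq_or_lt_of_le (Nat.succ_le_of_lt hN) with h | h
    · rw [← h, h0]
    · rcases eq_or_lt_of_le (Nat.succ_le_of_lt h) with h | h
      · rw [← h, h1]
      · exact coeff_eq_zero_of_natDegree_lt (by omega)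
  · rw [← hAG θ]
    ring

theorem isTrigPoly_mul_exp_neg_sq_of_coeff {d : ℕ} {A : ℝ[X]} {G : ℝ → ℂ}
    (hA : A.natDegree ≤ d + 2)
    (hAG : ∀ θ : ℝ, exp (θ * I) ^ (d + 2) * G θ = aeval (exp (θ * I) ^ 2) A)
    (h0 : A.coeff 0 = 0) (h1 : A.coeff 1 = 0) :
    IsTrigPoly d (fun θ => G θ * exp (-(θ * I)) ^ 2) := by
  refine ⟨A.divX.divX, ?_, fun θ => ?_⟩
  · rw [natDegree_divX_eq_natDegree_tsub_one, natDegree_divX_eq_natDegree_tsub_one]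
    omega
  · have h := hAG θ
    rw [← divX_mul_X_add A, h0, ← divX_mul_X_add A.divX, coeff_divX, zero_add, h1, C_0, add_zero,
      add_zero, map_mul, map_mul, aeval_X] at h
    refine mul_right_cancel₀ (pow_ne_zero 4 (exp_ne_zero (θ * I))) ?_
    have he := exp_mul_exp_neg_ofReal_mul_I θ
    linear_combination h + exp (θ * I) ^ (d + 2) * G θ *
      (exp (θ * I) * exp (-(θ * I)) + 1) * he

/-- Layer stripping for symmetric protocols: every normalized pair of trigonometric polynomials
with real coefficients comes from symmetric phases. -/
theorem isSymmetricProtocol_symMatrix_of_isTrigPoly {d : ℕ} {f : ℝ → ℝ} {G : ℝ → ℂ}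
    (hf : IsTrigPoly d (fun θ => f θ)) (hG : IsTrigPoly d G)
    (hfG : ∀ θ, f θ ^ 2 + normSq (G θ) = 1) :
    IsSymmetricProtocol (fun θ => symMatrix (f θ) (G θ)) := by
  induction d using Nat.strong_induction_on generalizing f G with
  | _ d ih =>
  -- A phase on both sides mixes f with Re G, so the top coefficient of f may be assumed to vanish.
  suffices key : ∀ (f : ℝ → ℝ) (G : ℝ → ℂ) (F A : ℝ[X]), F.natDegree ≤ d → A.natDegree ≤ d →
      (∀ θ : ℝ, exp (θ * I) ^ d * f θ = aeval (exp (θ * I) ^ 2) F) →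
      (∀ θ : ℝ, exp (θ * I) ^ d * G θ = aeval (exp (θ * I) ^ 2) A) →
      (∀ θ, f θ ^ 2 + normSq (G θ) = 1) → F.coeff d = 0 →
      IsSymmetricProtocol (fun θ => symMatrix (f θ) (G θ)) by
    obtain ⟨F, hF, hFf⟩ := hf
    obtain ⟨A, hA, hAG⟩ := hG
    -- B represents Re G, half the sum of G and its conjugate.
    set B : ℝ[X] := C (1 / 2) * (A + reflect d A) with hB
    have hBdeg : B.natDegree ≤ d := (natDegree_C_mul_le _ _).trans
      (natDegree_add_le_of_degree_le hA (natDegree_reflect_le.trans (max_le le_rfl hA)))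
    have hBG : ∀ θ : ℝ, exp (θ * I) ^ d * ((G θ).re : ℂ) = aeval (exp (θ * I) ^ 2) B := fun θ => by
      rw [hB, map_mul, map_add, ← hAG, ← aeval_reflect hA hAG, aeval_C, re_eq_add_conj, star_def,
        Complex.coe_algebraMap]
      push_cast
      ring
    obtain ⟨φ, hφ⟩ := exists_phase_eliminating (F.coeff d) (B.coeff d)
    refine isSymmetricProtocol_symMatrix_rotate φ
      (key _ _ (C (Real.cos (2 * φ)) * F + C (Real.sin (2 * φ)) * B)
        (C (Real.cos (2 * φ)) * B - C (Real.sin (2 * φ)) * F + (A - B)) ?_ ?_ ?_ ?_ ?_ ?_)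
    · exact natDegree_add_le_of_degree_le ((natDegree_C_mul_le _ _).trans hF)
        ((natDegree_C_mul_le _ _).trans hBdeg)
    · exact natDegree_add_le_of_degree_le (natDegree_sub_le_of_le
        ((natDegree_C_mul_le _ _).trans hBdeg) ((natDegree_C_mul_le _ _).trans hF)
        |>.trans (max_le le_rfl le_rfl))
        ((natDegree_sub_le_of_le hA hBdeg).trans (max_le le_rfl le_rfl))
    · intro θ
      simp only [map_add, map_mul, aeval_C, ← hFf, ← hBG, Complex.coe_algebraMap]
      push_cast
      ring
    · intro θ
      simp only [map_add, map_sub, map_mul, aeval_C, ← hFf, ← hBG, ← hAG, Complex.coe_algebraMap]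
      push_cast
      linear_combination (-exp (θ * I) ^ d) * (re_add_im (G θ)).symm
    · intro θ
      have h1 := hfG θ
      rw [normSq_apply] at h1
      rw [normSq_add_mul_I]
      linear_combination h1 +
        (f θ ^ 2 + (G θ).re ^ 2) * Real.cos_sq_add_sin_sq (2 * φ)
    · rw [coeff_add, coeff_C_mul, coeff_C_mul]
      linear_combination hφ
  clear hf hG hfG f G
  intro f G F A hF hA hFf hAG hfG hFd
  have hrefl := reflect_eq_self_of_ofReal hF hFf
  have hF0 : F.coeff 0 = 0 := by
    rw [← hrefl, coeff_reflect, revAt_zero, hFd]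
  have hmul := sq_add_mul_reflect hA hFf hAG hfG
  have hr0 : (reflect d A).coeff 0 = A.coeff d := by rw [coeff_reflect, revAt_zero]
  -- Since F has no constant term, F² contributes nothing in degrees 0 and 1. For d ≥ 2 this leaves
  -- A₀ A_d = 0 and A₀ A_{d-1} + A₁ A_d = 0.
  have hm0 := congrArg (fun p => coeff p 0) hmul
  have hm1 := congrArg (fun p => coeff p 1) hmul
  simp only [coeff_add, mul_coeff_zero, mul_coeff_one, hF0, hr0, coeff_X_pow] at hm0 hm1
  match d, ih, hF, hA, hFf, hAG, hFd, hr0, hm0, hm1, hrefl, hmul with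
  | 0, _, hF, hA, hFf, hAG, hFd, hr0, hm0, hm1, _, _ =>
    have hFz : F = 0 := by rw [eq_C_of_natDegree_le_zero hF, hF0, C_0]
    have hfz : ∀ θ, f θ = 0 := fun θ => by simpa [hFz] using hFf θ
    have hGc : ∀ θ, G θ = A.coeff 0 := fun θ => by
      have := hAG θ
      rw [eq_C_of_natDegree_le_zero hA] at this
      simpa using this
    simp only [hfz, hGc]
    have : A.coeff 0 * A.coeff 0 = 1 := by simpa using hm0
    rcases mul_self_eq_one_iff.1 this with h | h
    · simpa [h] using isSymmetricProtocol_symMatrix_one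
    · simpa [h] using isSymmetricProtocol_symMatrix_neg_one
  | 1, _, hF, hA, hFf, hAG, hFd, hr0, hm0, hm1, _, _ =>
    have hFz : F = 0 := by
      rw [eq_X_add_C_of_natDegree_le_one hF, hF0, hFd]
      simp
    have hfz : ∀ θ, f θ = 0 := fun θ => by simpa [hFz] using hFf θ
    have hGc : ∀ θ, G θ = A.coeff 1 * exp (θ * I) + A.coeff 0 * exp (-(θ * I)) := fun θ => by
      have h := hAG θ
      have he := exp_mul_exp_neg_ofReal_mul_I θ
      rw [eq_X_add_C_of_natDegree_le_one hA, map_add, map_mul, aeval_X, aeval_C, aeval_C,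
        Complex.coe_algebraMap] at h
      refine mul_left_cancel₀ (exp_ne_zero (θ * I)) ?_
      linear_combination h - A.coeff 0 * he
    have hr1 : (reflect 1 A).coeff 1 = A.coeff 0 := by
      rw [coeff_reflect, revAt_le le_rfl]
    rw [hr1] at hm1
    simp only [hfz, hGc]
    have hm0' : A.coeff 0 = 0 ∨ A.coeff 1 = 0 := by simpa using hm0
    have hm1' : A.coeff 0 * A.coeff 0 + A.coeff 1 * A.coeff 1 = 1 := by simpa using hm1
    rcases hm0' with h0 | h0
    · rw [h0, zero_mul, zero_add] at hm1'
      rcases mul_self_eq_one_iff.1 hm1' with h | h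
      · simpa [h, h0] using isSymmetricProtocol_symMatrix_exp
      · simpa [h, h0] using isSymmetricProtocol_symMatrix_neg_exp
    · rw [h0, zero_mul, add_zero] at hm1'
      rcases mul_self_eq_one_iff.1 hm1' with h | h
      · simpa [h, h0] using isSymmetricProtocol_symMatrix_exp_neg
      · simpa [h, h0] using isSymmetricProtocol_symMatrix_neg_exp_neg
  | k + 2, ih, hF, hA, hFf, hAG, hFd, hr0, hm0, hm1, _, _ =>
    have hr1 : (reflect (k + 2) A).coeff 1 = A.coeff (k + 1) := by
      rw [coeff_reflect, revAt_le (by omega)]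
      congr 1
    rw [hr1] at hm1
    have hm0' : A.coeff 0 = 0 ∨ A.coeff (k + 2) = 0 := by simpa using hm0
    have hm1' : A.coeff 0 * A.coeff (k + 1) + A.coeff 1 * A.coeff (k + 2) = 0 := by simpa using hm1
    have hf := isTrigPoly_of_coeff_zero (G := fun θ => f θ) hF hFf hF0 hFd
    have hnorm : ∀ θ : ℝ, normSq (exp (θ * I)) = 1 := fun θ => by
      rw [← Complex.sq_norm, norm_exp_ofReal_mul_I, one_pow]
    have hnorm' : ∀ θ : ℝ, normSq (exp (-(θ * I))) = 1 := fun θ => by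
      rw [← star_exp_ofReal_mul_I, star_def, normSq_conj, hnorm]
    have hup : A.coeff (k + 1) = 0 → A.coeff (k + 2) = 0 →
        IsSymmetricProtocol (fun θ => symMatrix (f θ) (G θ)) := fun h1 h2 =>
      isSymmetricProtocol_symMatrix_of_mul_exp_sq (ih k (by omega) hf
        (isTrigPoly_mul_exp_sq_of_coeff hA hAG h1 h2)
        fun θ => by rw [normSq_mul, map_pow, hnorm, one_pow, mul_one, hfG])
    have hdown : A.coeff 0 = 0 → A.coeff 1 = 0 →
        IsSymmetricProtocol (fun θ => symMatrix (f θ) (G θ)) := fun h1 h2 => by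
      convert isSymmetricProtocol_symMatrix_mul_exp_sq (ih k (by omega) hf
        (isTrigPoly_mul_exp_neg_sq_of_coeff hA hAG h1 h2)
        fun θ => by rw [normSq_mul, map_pow, hnorm', one_pow, mul_one, hfG]) using 3 with θ
      rw [mul_assoc, ← mul_pow, mul_comm (exp _), exp_mul_exp_neg_ofReal_mul_I, one_pow, mul_one]
    -- One end coefficient of A vanishes. If the other does not, the second relation kills the
    -- neighbour of the vanishing one, and a shift lowers the degree.
    by_cases h0 : A.coeff 0 = 0 <;> by_cases h2 : A.coeff (k + 2) = 0
    · exact ih k (by omega) hf (isTrigPoly_of_coeff_zero hA hAG h0 h2) hfG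
    · exact hdown h0 (by simpa [h0, h2] using hm1')
    · exact hup (by simpa [h0, h2] using hm1') h2
    · simp [h0, h2] at hm0'

end SymmetricQSP

/-! ### Realizing polynomials and approximating functions of definite parity -/

namespace SymmetricQSP

open Polynomial Complex
open QSP (Op phase signal protocol reversal IsSymmetric hadamard hadamardProtocol imTopRight)

theorem inv_sqrt_two_mul_self : ((Real.sqrt 2 : ℂ)⁻¹) * (Real.sqrt 2 : ℂ)⁻¹ = 1 / 2 := by
  rw [← mul_inv, ← ofReal_mul, Real.mul_self_sqrt zero_le_two]
  norm_num

/-- Hadamard conjugation turns i f σ_z into i f σ_x and leaves no other off-diagonal term. -/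
theorem imTopRight_hadamard_conj_symMatrix (f : ℝ) (G : ℂ) :
    imTopRight (hadamard * symMatrix f G * hadamard) = f := by
  have h : (hadamard * symMatrix f G * hadamard) 0 1 = f * I := by
    simp only [hadamard, symMatrix, Matrix.smul_mul, Matrix.mul_smul, smul_smul,
      inv_sqrt_two_mul_self, Matrix.mul_fin_two]
    simp
    ring
  rw [imTopRight, h]
  simp

/-- Spectral factorization of 1 - p² provides G, then layer stripping provides the phases. The bound
on the degree of r lets G share the degree d with p. -/
theorem exists_isSymmetric_imTopRight_eq {d : ℕ} {p : ℝ → ℝ}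
    (hp : IsTrigPoly d (fun θ => p (Real.cos θ))) {r : ℝ[X]} (hd : r.natDegree ≤ d)
    (hr : ∀ x ∈ Set.Icc (-1 : ℝ) 1, r.eval (x ^ 2) = 1 - p x ^ 2)
    (hp1 : ∀ x ∈ Set.Icc (-1 : ℝ) 1, |p x| < 1) :
    ∃ (n : ℕ) (Φ : Fin (n + 1) → ℝ), IsSymmetric Φ ∧
      ∀ x ∈ Set.Icc (-1 : ℝ) 1, imTopRight (hadamardProtocol Φ x) = p x := by
  have hpos : ∀ y ∈ Set.Icc (0 : ℝ) 1, 0 < r.eval y := fun y hy => by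
    have hx : √y ∈ Set.Icc (-1 : ℝ) 1 :=
      ⟨by linarith [Real.sqrt_nonneg y], Real.sqrt_le_one.2 hy.2⟩
    have h1 := hr _ hx
    rw [Real.sq_sqrt hy.1] at h1
    rw [h1]
    linarith [(sq_lt_one_iff_abs_lt_one _).2 (hp1 _ hx)]
  obtain ⟨G, hG, hG'⟩ := exists_isTrigPoly_normSq r hd hpos
  obtain ⟨n, Φ, hΦ, h⟩ := (isSymmetricProtocol_symMatrix_of_isTrigPoly hp hG fun θ => by
    rw [hG', hr _ ⟨Real.neg_one_le_cos θ, Real.cos_le_one θ⟩]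
    ring).exists_protocol_eq
  refine ⟨n, Φ, hΦ, fun x hx => ?_⟩
  rw [hadamardProtocol, h x hx, imTopRight_hadamard_conj_symMatrix, Real.cos_arccos hx.1 hx.2]

theorem exists_isSymmetric_even (q : ℝ[X])
    (hq : ∀ x ∈ Set.Icc (-1 : ℝ) 1, |q.eval (x ^ 2)| < 1) :
    ∃ (n : ℕ) (Φ : Fin (n + 1) → ℝ), IsSymmetric Φ ∧
      ∀ x ∈ Set.Icc (-1 : ℝ) 1, imTopRight (hadamardProtocol Φ x) = q.eval (x ^ 2) := by
  refine exists_isSymmetric_imTopRight_eq (p := fun x => q.eval (x ^ 2)) (r := 1 - q ^ 2)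
    (isTrigPoly_eval_cos_sq q) ?_ (fun x _ => by simp) hq
  exact (natDegree_sub_le_of_le natDegree_one.le natDegree_pow_le).trans (by simp)

theorem exists_isSymmetric_odd (q : ℝ[X])
    (hq : ∀ x ∈ Set.Icc (-1 : ℝ) 1, |x * q.eval (x ^ 2)| < 1) :
    ∃ (n : ℕ) (Φ : Fin (n + 1) → ℝ), IsSymmetric Φ ∧
      ∀ x ∈ Set.Icc (-1 : ℝ) 1, imTopRight (hadamardProtocol Φ x) = x * q.eval (x ^ 2) := by
  refine exists_isSymmetric_imTopRight_eq (p := fun x => x * q.eval (x ^ 2)) (r := 1 - X * q ^ 2)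
    (by simpa only [ofReal_mul] using isTrigPoly_cos.mul (isTrigPoly_eval_cos_sq q)) ?_
    (fun x _ => by simp; ring) hq
  exact (natDegree_sub_le_of_le natDegree_one.le
    (natDegree_mul_le_of_le natDegree_X_le natDegree_pow_le)).trans (by simp)

theorem exists_even_odd_decomposition (p : ℝ[X]) :
    ∃ a b : ℝ[X], ∀ x : ℝ, p.eval x = a.eval (x ^ 2) + x * b.eval (x ^ 2) := by
  induction p using Polynomial.induction_on' with
  | add p q hp hq =>
    obtain ⟨a, b, h⟩ := hp
    obtain ⟨a', b', h'⟩ := hq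
    exact ⟨a + a', b + b', fun x => by simp only [eval_add, h, h']; ring⟩
  | monomial n c =>
    rcases Nat.even_or_odd' n with ⟨k, rfl | rfl⟩
    · exact ⟨monomial k c, 0, fun x => by simp [pow_mul]⟩
    · exact ⟨0, monomial k c, fun x => by simp [pow_succ, pow_mul]; ring⟩

/-- Symmetric protocols approximate every continuous function of definite parity that stays away
from `±1`. -/
theorem exists_isSymmetric_near (f : C(QSP.X, ℝ)) {η ε : ℝ} (hη : 0 < η) (hε : 0 < ε)
    (hf : ∀ x, |f x| ≤ 1 - η) (k : Fin 2)
    (hk : ∀ x ∈ Set.Icc (-1 : ℝ) 1, QSP.ext f (-x) = (-1) ^ (k : ℕ) * QSP.ext f x) :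
    ∃ (n : ℕ) (Φ : Fin (n + 1) → ℝ), IsSymmetric Φ ∧
      ∀ x : QSP.X, |imTopRight (hadamardProtocol Φ x) - f x| < ε := by
  have hext : ∀ x : QSP.X, QSP.ext f x = f x := fun x => by
    rw [QSP.ext, Set.IccExtend_of_mem _ _ x.2]
  -- Precision η keeps the approximant strictly inside (-1, 1); precision ε is the goal.
  obtain ⟨p, hp⟩ := exists_polynomial_near_of_continuousOn (-1) 1 (QSP.ext f)
    (f.continuous.Icc_extend').continuousOn (min η ε) (lt_min hη hε)
  obtain ⟨a, b, hab⟩ := exists_even_odd_decomposition p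
  have hbound : ∀ x ∈ Set.Icc (-1 : ℝ) 1, |QSP.ext f x| ≤ 1 - η := fun x hx => by
    rw [hext ⟨x, hx⟩]
    exact hf _
  have hclose : ∀ u : ℝ → ℝ, (∀ x ∈ Set.Icc (-1 : ℝ) 1, |u x - QSP.ext f x| < min η ε) →
      ∀ x ∈ Set.Icc (-1 : ℝ) 1, |u x| < 1 := fun u hu x hx => by
    have h1 := abs_lt.1 ((hu x hx).trans_le (min_le_left _ _))
    have h2 := abs_le.1 (hbound x hx)
    rw [abs_lt]
    constructor <;> linarith
  have hfin : ∀ u : ℝ → ℝ, (∀ x ∈ Set.Icc (-1 : ℝ) 1, |u x - QSP.ext f x| < min η ε) →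
      (∃ (n : ℕ) (Φ : Fin (n + 1) → ℝ), IsSymmetric Φ ∧
        ∀ x ∈ Set.Icc (-1 : ℝ) 1, imTopRight (hadamardProtocol Φ x) = u x) →
      ∃ (n : ℕ) (Φ : Fin (n + 1) → ℝ), IsSymmetric Φ ∧
        ∀ x : QSP.X, |imTopRight (hadamardProtocol Φ x) - f x| < ε := by
    rintro u hu ⟨n, Φ, hΦ, h⟩
    refine ⟨n, Φ, hΦ, fun x => ?_⟩
    rw [h x x.2, ← hext x]
    exact (hu x x.2).trans_le (min_le_right _ _)
  have hneg : ∀ x ∈ Set.Icc (-1 : ℝ) 1, -x ∈ Set.Icc (-1 : ℝ) 1 := fun x hx =>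
    ⟨by linarith [hx.2], by linarith [hx.1]⟩
  fin_cases k
  -- Averaging the estimates at x and -x shows that the even part alone is as close to f as p; the
  -- odd case is the same with a sign.
  · have hu : ∀ x ∈ Set.Icc (-1 : ℝ) 1, |a.eval (x ^ 2) - QSP.ext f x| < min η ε := fun x hx => by
      have h1 := abs_lt.1 (hp x hx)
      have h2 := abs_lt.1 (hp (-x) (hneg x hx))
      have h3 := hk x hx
      simp only [hab, neg_sq] at h1 h2
      simp at h3
      rw [abs_lt]
      constructor <;> linarith
    exact hfin (fun x => a.eval (x ^ 2)) hu (exists_isSymmetric_even a (hclose _ hu))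
  · have hu : ∀ x ∈ Set.Icc (-1 : ℝ) 1, |x * b.eval (x ^ 2) - QSP.ext f x| < min η ε := by
      intro x hx
      have h1 := abs_lt.1 (hp x hx)
      have h2 := abs_lt.1 (hp (-x) (hneg x hx))
      have h3 := hk x hx
      simp only [hab, neg_sq] at h1 h2
      simp at h3
      rw [abs_lt]
      constructor <;> linarith
    exact hfin (fun x => x * b.eval (x ^ 2)) hu (exists_isSymmetric_odd b (hclose _ hu))

end SymmetricQSP

/-! ### Density of the two ansätze -/

namespace QSP

theorem hadamard_mul_hadamard : hadamard * hadamard = 1 := by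
  simp only [hadamard, Matrix.smul_mul, Matrix.mul_smul, smul_smul,
    SymmetricQSP.inv_sqrt_two_mul_self, Matrix.mul_fin_two]
  ext i j
  fin_cases i <;> fin_cases j <;> norm_num

/-- With symmetric phases the linear combination is trivial: both protocols agree. -/
theorem lcu_of_isSymmetric {n : ℕ} {Φ : Fin (n + 1) → ℝ} (hΦ : IsSymmetric Φ) (x : ℝ) :
    lcu Φ x = (1 : Op) ⊗ₖ hadamardProtocol Φ x := by
  have h1 : (!![1, 0; 0, 0] : Op) + !![0, 0; 0, 1] = 1 := by
    ext i j
    fin_cases i <;> fin_cases j <;> simp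
  rw [lcu, hΦ, ← Matrix.add_kronecker, h1, ← Matrix.mul_kronecker_mul, ← Matrix.mul_kronecker_mul,
    mul_one, hadamard_mul_hadamard, one_mul, mul_one]

/-- For m = 0 the QSVT is V itself, and the gates -iσ_x and iσ_x cancel. -/
theorem zeroBlock_composedProtocol_zero {n : ℕ} {Φ : Fin (n + 1) → ℝ} (hΦ : IsSymmetric Φ)
    (x : ℝ) : zeroBlock (composedProtocol Φ 0 x) = hadamardProtocol Φ x := by
  have hX : ((-Complex.I) • pauliX) * (Complex.I • pauliX) = 1 := by
    rw [Matrix.smul_mul, Matrix.mul_smul, smul_smul, neg_mul, Complex.I_mul_I, neg_neg, one_smul,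
      pauliX, Matrix.mul_fin_two]
    ext i j
    fin_cases i <;> fin_cases j <;> simp
  rw [composedProtocol, trivialQSVT, pow_zero, mul_one, blockEncoding, mul_assoc,
    ← Matrix.mul_kronecker_mul, hX, one_mul, Matrix.one_kronecker_one, mul_one,
    lcu_of_isSymmetric hΦ]
  ext i j
  simp [zeroBlock]

theorem symmetricAnsatz_subset_composedAnsatz : symmetricAnsatz ⊆ composedAnsatz := by
  rintro _ ⟨n, Φ, hΦ, rfl⟩
  exact ⟨n, Φ, 0, hΦ, funext fun x => (zeroBlock_composedProtocol_zero hΦ x).symm⟩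

theorem isDenseUnder_symmetricAnsatz {δ : ℝ} (ξ C : ℝ) (hδ : 0 < δ) :
    IsDenseUnder imTopRight symmetricAnsatz (closedClass ξ δ C) := by
  intro ε hε f hf
  obtain ⟨g, ⟨⟨-, ⟨k, hk⟩, -⟩, hg, -⟩, hfg⟩ := Metric.mem_closure_iff.1 hf (ε / 2) (half_pos hε)
  obtain ⟨n, Φ, hΦ, h⟩ := SymmetricQSP.exists_isSymmetric_near g hδ (half_pos hε) hg k hk
  refine ⟨_, ⟨n, Φ, hΦ, rfl⟩, fun x => ?_⟩
  have h1 : |f x - g x| < ε / 2 := (ContinuousMap.dist_apply_le_dist x).trans_lt hfg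
  have h2 := abs_lt.1 (h x)
  have h3 := abs_lt.1 h1
  rw [abs_lt]
  constructor <;> linarith

theorem isDenseUnder_composedAnsatz {δ : ℝ} (ξ C : ℝ) (hδ : 0 < δ) :
    IsDenseUnder imTopRight composedAnsatz (closedClass ξ δ C) := fun ε hε f hf =>
  let ⟨U, hU, h⟩ := isDenseUnder_symmetricAnsatz ξ C hδ ε hε f hf
  ⟨U, symmetricAnsatz_subset_composedAnsatz hU, h⟩

/-! ### The function classes -/

theorem isClosed_setOf_forall_abs_le (c : ℝ) : IsClosed {f : C(X, ℝ) | ∀ x, |f x| ≤ c} := by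
  simp only [Set.ofPred_forall]
  exact isClosed_iInter fun x => isClosed_le (by fun_prop) continuous_const

theorem abs_le_one_of_mem_closure_commonSpace {ξ : ℝ} {f : C(X, ℝ)}
    (hf : f ∈ closure (commonSpace ξ)) (x : X) : |f x| ≤ 1 :=
  closure_minimal (fun _ h => h.1) (isClosed_setOf_forall_abs_le 1) hf x

theorem abs_le_of_mem_closedClass {ξ δ C : ℝ} {f : C(X, ℝ)} (hf : f ∈ closedClass ξ δ C) (x : X) :
    |f x| ≤ 1 - δ :=
  closure_minimal (fun _ h => h.2.1) (isClosed_setOf_forall_abs_le (1 - δ)) hf x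

theorem one_mem_commonSpace {ξ : ℝ} (hξ : 0 < ξ) : (1 : C(X, ℝ)) ∈ commonSpace ξ := by
  have h : ext 1 = fun _ => 1 := rfl
  refine ⟨fun x => by simp, ⟨0, fun x _ => by simp [h]⟩, fun x _ => ⟨0, by simpa using hξ.le, ?_⟩⟩
  rw [h]
  exact hasDerivWithinAt_const _ _ _

/-- The mean value inequality on the convex interval; it supplies the equicontinuity for
Arzelà–Ascoli. -/
theorem dist_le_of_mem_commonSpace {ξ : ℝ} {f : C(X, ℝ)} (hf : f ∈ commonSpace ξ) (x y : X) :
    dist (f x) (f y) ≤ ξ * dist x y := by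
  choose! d hd hd' using hf.2.2
  have := (convex_Icc (-1 : ℝ) 1).norm_image_sub_le_of_norm_hasDerivWithin_le
    (fun z hz => hd' z hz) (fun z hz => hd z hz) y.2 x.2
  rw [ext, Set.IccExtend_of_mem _ _ x.2, Set.IccExtend_of_mem _ _ y.2] at this
  simpa [Real.dist_eq, Subtype.dist_eq] using this

theorem isCompact_closure_commonSpace (ξ : ℝ) : IsCompact (closure (commonSpace ξ)) := by
  let e := (ContinuousMap.isometryEquivBoundedOfCompact X ℝ).toHomeomorph
  rw [← e.isCompact_image, e.image_closure]
  refine BoundedContinuousFunction.arzela_ascoli (Set.Icc (-1) 1) isCompact_Icc _ ?_ ?_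
  · rintro _ x ⟨f, hf, rfl⟩
    exact abs_le.1 (hf.1 x)
  · refine (LipschitzWith.uniformEquicontinuous _ ξ.toNNReal ?_).equicontinuous
    rintro ⟨_, f, hf, rfl⟩
    refine LipschitzWith.of_dist_le_mul fun x y => (dist_le_of_mem_commonSpace hf x y).trans ?_
    exact mul_le_mul_of_nonneg_right (Real.le_coe_toNNReal ξ) dist_nonneg

theorem isCompact_closedClass (ξ δ C : ℝ) : IsCompact (closedClass ξ δ C) :=
  (isCompact_closure_commonSpace ξ).of_isClosed_subset isClosed_closure
    (closure_mono fun _ h => h.1)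

/-- The constant 1 separates the two: the bound 1 - δ survives the closure. -/
theorem closedClass_ssubset {ξ δ : ℝ} (C : ℝ) (hξ : 0 < ξ) (hδ : 0 < δ) :
    closedClass ξ δ C ⊂ closure (commonSpace ξ) := by
  refine ⟨closure_mono fun _ h => h.1, fun h => ?_⟩
  have := abs_le_of_mem_closedClass (h (subset_closure (one_mem_commonSpace hξ))) ⟨0, by simp⟩
  simp at this
  linarith

theorem closure_commonSpace_ssubset_univ (ξ : ℝ) : closure (commonSpace ξ) ⊂ Set.univ := by
  refine ⟨Set.subset_univ _, fun h => ?_⟩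
  have := abs_le_one_of_mem_closure_commonSpace (h (Set.mem_univ (ContinuousMap.const X (2 : ℝ))))
    ⟨0, by simp⟩
  norm_num at this

end QSP

theorem mainTheorem5 (ξ δ C : ℝ) (hξ : 0 < ξ) (hδ : 0 < δ) :
    IsCompact (QSP.closedClass ξ δ C) ∧
    QSP.closedClass ξ δ C ⊂ closure (QSP.commonSpace ξ) ∧
    closure (QSP.commonSpace ξ) ⊂ Set.univ ∧
    QSP.IsDenseUnder QSP.imTopRight QSP.symmetricAnsatz (QSP.closedClass ξ δ C) ∧
    QSP.IsDenseUnder QSP.imTopRight QSP.composedAnsatz (QSP.closedClass ξ δ C) :=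
  ⟨QSP.isCompact_closedClass ξ δ C, QSP.closedClass_ssubset C hξ hδ,
    QSP.closure_commonSpace_ssubset_univ ξ, QSP.isDenseUnder_symmetricAnsatz ξ C hδ,
    QSP.isDenseUnder_composedAnsatz ξ C hδ⟩
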